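/- Closed balls may have radius $0$. For a nonempty compact set $B\subset\mathbb R^d$ ($d\ge 1$), let $\mathrm{inscr}(B)$ be a largest closed ball contained in $B$, with center $x_B$, and let $\mathrm{escribed}(B)$ be the smallest closed ball centered at $x_B$ that contains $B$; if there are several largest inscribed balls, one is chosen for which the radius of $\mathrm{escribed}(B)$ is minimal. Write $r(D)$ for the radius of a ball $D$. A family $\mathcal F$ of nonempty compact sets in $\mathbb R^d$ (repetitions allowed) is a family of compact near-balls if there is a constant $K=K(\mathcal F)$ such that for every $B\in\mathcal F$, $$r(\mathrm{escribed}(B))\le K\cdot r(\mathrm{inscr}(B))\quad\text{and}\quad r(\mathrm{escribed}(B))\le K+r(\mathrm{inscr}(B)).$$ A $k$-flat is a $k$-dimensional affine subspace of $\mathbb R^d$; it pierces a set if it meets it. Members of a family are counted with multiplicity. **Theorem 1.3.** Let $d$ and $k$ be integers with $0\le k\le d-1$, and let $\mathcal F$ be a family of compact near-balls in $\mathbb R^d$. 1. If $\mathcal F$ is infinite and among every $\aleph_0$ members of $\mathcal F$ there are some $k+2$ that are pierced by a single $k$-flat, then $\mathcal F$ can be pierced by finitely many $k$-flats, that is, there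 is a finite set of $k$-flats such that every member of $\mathcal F$ is pierced by at least one of them. 2. Exactly one of the following two conditions holds: (a) $\mathcal F$ can be pierced by finitely many $k$-flats; (b) $\mathcal F$ contains an infinite sequence of members that is $k$-independent, i.e. no $k$-flat pierces $k+2$ members of the sequence. -/

import Mathlib

/-- `closedBall x r` is a largest closed ball inscribed in `B`; radius `0` (a single point) is
allowed, as is forced for sets with empty interior. -/
def IsLargestInscribedBall {d : ℕ} (B : Set (EuclideanSpace ℝ (Fin d)))
    (x : EuclideanSpace ℝ (Fin d)) (r : ℝ) : Prop :=
  0 ≤ r ∧ Metric.closedBall x r ⊆ B ∧ ∀ y s, Metric.closedBall y s ⊆ B → s ≤ r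

/-- `R` is the radius of the smallest closed ball centered at `x` that contains `B`. -/
def IsEscribedRadius {d : ℕ} (B : Set (EuclideanSpace ℝ (Fin d)))
    (x : EuclideanSpace ℝ (Fin d)) (R : ℝ) : Prop :=
  IsLeast {ρ : ℝ | 0 ≤ ρ ∧ B ⊆ Metric.closedBall x ρ} R

/-- `closedBall x r` is an admissible choice of `inscr(B)` and `closedBall x R` is the
corresponding `escribed(B)`: among the largest inscribed balls, one is chosen whose escribed radius
is minimal. The numbers `r` and `R` do not depend on how remaining ties are broken. -/
def IsInscrEscr {d : ℕ} (B : Set (EuclideanSpace ℝ (Fin d)))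
    (x : EuclideanSpace ℝ (Fin d)) (r R : ℝ) : Prop :=
  IsLargestInscribedBall B x r ∧ IsEscribedRadius B x R ∧
    ∀ y R', IsLargestInscribedBall B y r → IsEscribedRadius B y R' → R ≤ R'

/-- A family of near-balls (repetitions allowed): nonempty sets with one constant `K` such that
`r(escribed(B)) ≤ K * r(inscr(B))` and `r(escribed(B)) ≤ K + r(inscr(B))` for all members `B`. -/
def IsNearBallFamily {d : ℕ} {ι : Type*} (F : ι → Set (EuclideanSpace ℝ (Fin d))) : Prop :=
  (∀ i, (F i).Nonempty) ∧
    ∃ K : ℝ, ∀ i, ∃ x r R, IsInscrEscr (F i) x r R ∧ R ≤ K * r ∧ R ≤ K + r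

/-- A `k`-flat: a `k`-dimensional (nonempty) affine subspace. -/
def IsFlat {d : ℕ} (k : ℕ) (J : AffineSubspace ℝ (EuclideanSpace ℝ (Fin d))) : Prop :=
  (J : Set (EuclideanSpace ℝ (Fin d))).Nonempty ∧ Module.finrank ℝ J.direction = k

/-- The flat `J` pierces (meets) the set `B`. -/
def Pierces {d : ℕ} (J : AffineSubspace ℝ (EuclideanSpace ℝ (Fin d)))
    (B : Set (EuclideanSpace ℝ (Fin d))) : Prop :=
  ((J : Set (EuclideanSpace ℝ (Fin d))) ∩ B).Nonempty

/-- The `(ℵ₀, q)`-property with respect to `k`-flats: among every `ℵ₀` members of the family, some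
`q` can be pierced by a single `k`-flat (members are counted with multiplicity). -/
def AlephZeroProperty {d : ℕ} {ι : Type*} (q k : ℕ)
    (F : ι → Set (EuclideanSpace ℝ (Fin d))) : Prop :=
  ∀ S : Set ι, Cardinal.mk S = Cardinal.aleph0 →
    ∃ T : Finset ι, (T : Set ι) ⊆ S ∧ T.card = q ∧
      ∃ J : AffineSubspace ℝ (EuclideanSpace ℝ (Fin d)), IsFlat k J ∧ ∀ i ∈ T, Pierces J (F i)

/-- The family can be pierced by finitely many `k`-flats. -/
def HasFiniteFlatTransversal {d : ℕ} {ι : Type*} (k : ℕ)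
    (F : ι → Set (EuclideanSpace ℝ (Fin d))) : Prop :=
  ∃ P : Set (AffineSubspace ℝ (EuclideanSpace ℝ (Fin d))), P.Finite ∧
    (∀ J ∈ P, IsFlat k J) ∧ ∀ i, ∃ J ∈ P, Pierces J (F i)

/-- An infinite sequence of sets is `k`-independent: no `k`-flat meets `k + 2` of its members. -/
def IsIndependentSeq {d : ℕ} (k : ℕ) (B : ℕ → Set (EuclideanSpace ℝ (Fin d))) : Prop :=
  ∀ J : AffineSubspace ℝ (EuclideanSpace ℝ (Fin d)), IsFlat k J →
    ¬ ∃ T : Finset ℕ, T.card = k + 2 ∧ ∀ n ∈ T, Pierces J (B n)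

/-- The family contains an infinite sequence of (differently indexed) members that is
`k`-independent. -/
def HasInfiniteIndependentSeq {d : ℕ} {ι : Type*} (k : ℕ)
    (F : ι → Set (EuclideanSpace ℝ (Fin d))) : Prop :=
  ∃ s : ℕ → ι, Function.Injective s ∧ IsIndependentSeq k (fun n => F (s n))

open Filter Topology Metric

/-! The substance is that a family without a finite transversal contains a `k`-independent sequence;
the converse direction is the pigeonhole principle. The index sets pierced by finitely many
`k`-flats form a proper ideal, so some ultrafilter `U` makes every `k`-flat miss `U`-almost all
members (`exists_ultrafilter_avoids`). Lift `x` to `(1, x)`: `k`-flats become subspaces of dimension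
at most `k + 1`, and `k`-independence follows once any points chosen from `k + 2` members have
linearly independent lifts.

The sequence is chosen greedily. A flag `V m` stands for `m` members still to be chosen: `V (m + 1)`
adds to `V m` the limit `v`, along `U`, of the lifts modulo `V m` up to scaling. If `T` is
independent modulo `V (m + 1)`, then, as linear independence is an open condition and the sets are
compact, adding almost any member to `T` leaves it independent modulo `V m`
(`IndepMod.eventually_insert`).

This needs `v` not to depend on the points chosen. A ball large compared with its distance from `V`
would meet a fixed flat, so almost all balls are relatively small, and the multiplicative bound
gives all selections one limit. This can fail only when `V` has dimension `k` and lies at infinity,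
the hyperplane of first coordinate `0`. The additive bound then sends all limits to infinity
(`IsCored.common_limit_or_limits_at_infinity`), which suffices because `T` is then a single member.
-/

theorem IsCompact.exists_tendsto_ultrafilter {ι X : Type*} [TopologicalSpace X] {s : Set X}
    (hs : IsCompact s) (U : Ultrafilter ι) {f : ι → X} (hf : ∀ᶠ i in U, f i ∈ s) :
    ∃ a ∈ s, Tendsto f U (𝓝 a) :=
  hs.ultrafilter_le_nhds' (U.map f) hf

/-! ### Greedy choice of a sequence along a filter -/

/-- In `Q m T`, `m` counts the members still to be added to `T`. Each new index must suit all the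
finitely many subsets of the earlier choices, which is a finite intersection of eventual conditions.
-/
theorem exists_injective_seq_of_eventually {ι : Type*} [DecidableEq ι] (U : Filter ι) [NeBot U]
    (hU : ∀ j, ∀ᶠ i in U, i ≠ j) (Q : ℕ → Finset ι → Prop) (n : ℕ) (h0 : Q n ∅)
    (hQ : ∀ m T, Q (m + 1) T → ∀ᶠ i in U, Q m (insert i T)) :
    ∃ s : ℕ → ι, Function.Injective s ∧ ∀ T : Finset ℕ, T.card = n → Q 0 (T.image s) := by
  let Inv : Finset ι → Prop := fun S => ∀ T ⊆ S, T.card ≤ n → Q (n - T.card) T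
  have step : ∀ S : {S : Finset ι // Inv S}, ∃ i, i ∉ S.1 ∧ Inv (insert i S.1) := by
    rintro ⟨S, hS⟩
    have h1 : ∀ᶠ i in U, ∀ j ∈ S, i ≠ j := (Finset.eventually_all S).2 fun j _ => hU j
    have h2 : ∀ᶠ i in U, ∀ T ∈ S.powerset, T.card < n → Q (n - T.card - 1) (insert i T) := by
      refine (Finset.eventually_all _).2 fun T hT => ?_
      by_cases hc : T.card < n
      · have := hS T (Finset.mem_powerset.1 hT) hc.le
        rw [show n - T.card = (n - T.card - 1) + 1 by omega] at this
        exact (hQ _ _ this).mono fun i hi _ => hi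
      · exact Eventually.of_forall fun i hi => absurd hi hc
    obtain ⟨i, hi1, hi2⟩ := (h1.and h2).exists
    have hiS : i ∉ S := fun h => hi1 i h rfl
    refine ⟨i, hiS, fun T hT hc => ?_⟩
    by_cases hi : i ∈ T
    · have hcard := Finset.card_erase_add_one hi
      have := hi2 (T.erase i) (Finset.mem_powerset.2 (Finset.subset_insert_iff.1 hT)) (by omega)
      rwa [Finset.insert_erase hi, show n - (T.erase i).card - 1 = n - T.card by omega] at this
    · exact hS T ((Finset.subset_insert_iff_of_notMem hi).1 hT) hc
  choose f hf hf' using step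
  have hInv0 : Inv ∅ := by
    intro T hT _
    rw [Finset.subset_empty.1 hT]
    simpa using h0
  let A : ℕ → {S : Finset ι // Inv S} :=
    fun m => Nat.rec ⟨∅, hInv0⟩ (fun _ S => ⟨insert (f S) S.1, hf' S⟩) m
  have hA : ∀ m, (A (m + 1)).1 = insert (f (A m)) (A m).1 := fun m => rfl
  have hmono : Monotone fun m => (A m).1 :=
    monotone_nat_of_le_succ fun m => by rw [hA]; exact Finset.subset_insert _ _
  have hmem : ∀ {a b}, a < b → f (A a) ∈ (A b).1 := fun {a b} hab =>
    hmono (Nat.succ_le_of_lt hab) (by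
      change f (A a) ∈ (A (a + 1)).1
      rw [hA]; exact Finset.mem_insert_self _ _)
  have hinj : Function.Injective fun m => f (A m) := by
    intro a b hab
    by_contra hne
    rcases lt_or_gt_of_ne hne with h | h
    · exact hf (A b) ((show f (A a) = f (A b) from hab) ▸ hmem h)
    · exact hf (A a) ((show f (A a) = f (A b) from hab).symm ▸ hmem h)
  refine ⟨fun m => f (A m), hinj, fun T hT => ?_⟩
  have hc : (T.image fun m => f (A m)).card = n := by
    rw [Finset.card_image_of_injective _ hinj, hT]
  have hsub : (T.image fun m => f (A m)) ⊆ (A (T.sup id + 1)).1 := by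
    intro j hj
    obtain ⟨m, hm, rfl⟩ := Finset.mem_image.1 hj
    exact hmem (Nat.lt_succ_of_le (Finset.le_sup (f := id) hm))
  have := (A (T.sup id + 1)).2 _ hsub hc.le
  rwa [hc, Nat.sub_self] at this

/-! ### Limits of lifts and persistence of independence -/

section Projective

variable {ι X : Type*} [NormedAddCommGroup X] [NormedSpace ℝ X]

/-- The selection `y` converges along `U`, in the projective space of the quotient by `V`,
to the class of `v`. -/
def ApproachesMod (U : Ultrafilter ι) (V : Submodule ℝ (ℝ × X)) (y : ι → X) (v : ℝ × X) : Prop :=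
  ∃ t : ι → ℝ, Tendsto (fun i => t i • V.mkQ ((1 : ℝ), y i)) U (𝓝 (V.mkQ v))

/-- The homogeneous lifts of any points chosen in the sets indexed by `T` are linearly independent
modulo `V`. -/
def IndepMod (F : ι → Set X) (V : Submodule ℝ (ℝ × X)) (T : Finset ι) : Prop :=
  ∀ x : ι → X, (∀ i ∈ T, x i ∈ F i) → ∀ g : ι → ℝ, ∑ i ∈ T, g i • ((1 : ℝ), x i) ∈ V →
    ∀ i ∈ T, g i = 0

variable [FiniteDimensional ℝ X]

instance isClosed_submodule_real_prod (V : Submodule ℝ (ℝ × X)) : IsClosed (V : Set (ℝ × X)) :=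
  V.closed_of_finiteDimensional

/-- Were the conclusion false, dependent selections would exist for almost all `i`. The points over
`T` converge by compactness, the rescaled lift from `F i` tends to `v`, and the limit vectors are
independent modulo `V`; so are nearby ones, a contradiction. -/
theorem IndepMod.eventually_insert [DecidableEq ι] {F : ι → Set X} {U : Ultrafilter ι}
    {V : Submodule ℝ (ℝ × X)} {T : Finset ι} (hF : ∀ i, IsCompact (F i))
    (hne : ∀ i, (F i).Nonempty) (hT : ∀ᶠ i in U, i ∉ T)
    (h : ∀ y : ι → X, (∀ i, y i ∈ F i) →
      ∃ v ∉ V, ApproachesMod U V y v ∧ IndepMod F (V ⊔ Submodule.span ℝ {v}) T) :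
    ∀ᶠ i in U, IndepMod F V (insert i T) := by
  by_contra hcon
  rw [← Ultrafilter.eventually_not] at hcon
  have key : ∀ i, ∃ p : ι → X, (∀ j, p j ∈ F j) ∧ (¬ IndepMod F V (insert i T) →
      ∃ g : ι → ℝ, ∑ j ∈ insert i T, g j • ((1 : ℝ), p j) ∈ V ∧ ∃ j ∈ insert i T, g j ≠ 0) := by
    intro i
    choose p hp using hne
    by_cases hi : IndepMod F V (insert i T)
    · exact ⟨p, hp, fun h => absurd hi h⟩
    · have hi' := hi
      unfold IndepMod at hi'
      push Not at hi'
      obtain ⟨x, hx, g, hg, j, hj, hgj⟩ := hi'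
      -- The default points `p` make the choice total, so that its diagonal is a selection to which
      -- `h` applies.
      refine ⟨fun j => if j ∈ insert i T then x j else p j, fun j => ?_, fun _ => ⟨g, ?_, j, hj, hgj⟩⟩
      · by_cases hj : j ∈ insert i T
        · simpa only [if_pos hj] using hx j hj
        · simpa only [if_neg hj] using hp j
      · convert hg using 1
        exact Finset.sum_congr rfl fun j hj => by simp only [if_pos hj]
  choose x hx hg using key
  obtain ⟨v, hvV, ⟨t, ht⟩, hind⟩ := h (fun i => x i i) fun i => hx i i
  have hlim : ∀ j, ∃ a ∈ F j, Tendsto (fun i => x i j) U (𝓝 a) := fun j =>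
    (hF j).exists_tendsto_ultrafilter U (Eventually.of_forall fun i => hx i j)
  choose a ha hax using hlim
  let w : ι → Option T → (ℝ × X) ⧸ V := fun i o =>
    o.elim (t i • V.mkQ ((1 : ℝ), x i i)) fun j => V.mkQ ((1 : ℝ), x i j)
  let w' : Option T → (ℝ × X) ⧸ V := fun o => o.elim (V.mkQ v) fun j => V.mkQ ((1 : ℝ), a j)
  have hπ : Continuous V.mkQ := V.mkQ.continuous_of_finiteDimensional
  have hww' : Tendsto w U (𝓝 w') := by
    rw [tendsto_pi_nhds]
    rintro (_ | j)
    · exact ht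
    · exact (hπ.tendsto _).comp (tendsto_const_nhds.prodMk_nhds (hax j))
  have hLI : LinearIndependent ℝ w' := by
    rw [Fintype.linearIndependent_iff]
    intro g hg0
    rw [Fintype.sum_option] at hg0
    let G : ι → ℝ := fun j => if hj : j ∈ T then g (some ⟨j, hj⟩) else 0
    have hsum : ∑ j : T, g (some j) • ((1 : ℝ), a j) = ∑ j ∈ T, G j • ((1 : ℝ), a j) := by
      rw [← Finset.sum_coe_sort T]
      refine Finset.sum_congr rfl fun j _ => ?_
      simp [G]
    have hmem : g none • v + ∑ j ∈ T, G j • ((1 : ℝ), a j) ∈ V := by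
      rw [← hsum, ← Submodule.ker_mkQ V, LinearMap.mem_ker, map_add, map_smul, map_sum]
      simpa only [w', Option.elim, map_smul] using hg0
    have hG : ∀ j ∈ T, G j = 0 := by
      refine hind a (fun j _ => ha j) G ?_
      have h1 : g none • v ∈ Submodule.span ℝ {v} :=
        Submodule.smul_mem _ _ (Submodule.mem_span_singleton_self v)
      have := Submodule.sub_mem _ (Submodule.mem_sup_left (T := Submodule.span ℝ {v}) hmem)
        (Submodule.mem_sup_right (S := V) h1)
      simpa using this
    have hnone : g none = 0 := by
      rw [Finset.sum_eq_zero fun j hj => by rw [hG j hj, zero_smul], add_zero] at hmem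
      by_contra h0
      exact hvV ((V.smul_mem_iff h0).1 hmem)
    rintro (_ | j)
    · exact hnone
    · simpa [G] using hG j j.2
  obtain ⟨i, ⟨hi, hiT⟩, hib⟩ := ((hww'.eventually hLI.eventually).and hT |>.and hcon).exists
  obtain ⟨g, hgV, hgne⟩ := hg i hib
  have hti : t i ≠ 0 := fun h0 => hi.ne_zero none (by simp [w, h0])
  rw [Fintype.linearIndependent_iff] at hi
  have := hi (fun o => o.elim (g i / t i) fun j => g j) (by
    rw [Fintype.sum_option]
    rw [Finset.sum_insert hiT, ← Submodule.ker_mkQ V, LinearMap.mem_ker, map_add, map_smul,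
      map_sum, ← Finset.sum_coe_sort T] at hgV
    simp only [w, Option.elim, smul_smul, div_mul_cancel₀ _ hti]
    simpa only [map_smul] using hgV)
  obtain ⟨j, hj, hgj⟩ := hgne
  rcases Finset.mem_insert.1 hj with rfl | hj
  · have := this none
    simp only [Option.elim, div_eq_zero_iff] at this
    tauto
  · exact hgj (this (some ⟨j, hj⟩))

end Projective

/-! ### Near-balls: relative size and common limits -/

section Projective

variable {ι X : Type*} [NormedAddCommGroup X]

/-- Every `F i` contains the ball of center `c i` and radius `r i`, and lies in a concentric ball
whose radius is bounded both multiplicatively and additively in terms of `r i`. -/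
structure IsCored (F : ι → Set X) (c : ι → X) (r : ι → ℝ) (K : ℝ) : Prop where
  nonneg : ∀ i, 0 ≤ r i
  inner : ∀ i, closedBall (c i) (r i) ⊆ F i
  mul_bound : ∀ i, ∀ x ∈ F i, ‖x - c i‖ ≤ K * r i
  add_bound : ∀ i, ∀ x ∈ F i, ‖x - c i‖ ≤ K + r i

theorem IsCored.center_mem {F : ι → Set X} {c : ι → X} {r : ι → ℝ} {K : ℝ}
    (h : IsCored F c r K) (i : ι) : c i ∈ F i :=
  h.inner i (mem_closedBall_self (h.nonneg i))

variable [NormedSpace ℝ X]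

/-- Each linear subspace of dimension at most `n` misses the homogeneous lifts of almost all
members of the family. -/
def Avoids (U : Ultrafilter ι) (F : ι → Set X) (n : ℕ) : Prop :=
  ∀ W : Submodule ℝ (ℝ × X), Module.finrank ℝ W ≤ n → ∀ᶠ i in U, ∀ x ∈ F i, ((1 : ℝ), x) ∉ W

theorem mkQ_ne_zero_of_notMem {V : Submodule ℝ (ℝ × X)} {x : ℝ × X} (h : x ∉ V) : V.mkQ x ≠ 0 := by
  rwa [Ne, ← LinearMap.mem_ker, Submodule.ker_mkQ]

theorem Submodule.mem_sup_span_singleton_of_mkQ_eq {E : Type*} [AddCommGroup E] [Module ℝ E]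
    {V : Submodule ℝ E} {x v : E} (a : ℝ) (h : V.mkQ x = a • V.mkQ v) :
    x ∈ V ⊔ Submodule.span ℝ {v} := by
  have h1 : x - a • v ∈ V := by
    rw [← Submodule.ker_mkQ V, LinearMap.mem_ker, map_sub, map_smul, h, sub_self]
  have := Submodule.add_mem _ (Submodule.mem_sup_left (T := Submodule.span ℝ {v}) h1)
    (Submodule.mem_sup_right (S := V)
      (Submodule.smul_mem _ a (Submodule.mem_span_singleton_self v)))
  simpa using this

theorem Submodule.finrank_sup_span_singleton_le {E : Type*} [AddCommGroup E] [Module ℝ E]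
    [FiniteDimensional ℝ E] (V : Submodule ℝ E) (v : E) :
    Module.finrank ℝ ↥(V ⊔ Submodule.span ℝ {v}) ≤ Module.finrank ℝ V + 1 := by
  refine (Submodule.finrank_add_le_finrank_add_finrank _ _).trans ?_
  have := finrank_span_le_card (R := ℝ) ({v} : Set E)
  simp at this
  omega

variable [FiniteDimensional ℝ X] {U : Ultrafilter ι} {F : ι → Set X} {c : ι → X} {r : ι → ℝ}
  {K : ℝ} {V : Submodule ℝ (ℝ × X)}

theorem norm_mkQ_le_of_le {V' : Submodule ℝ (ℝ × X)} (h : V ≤ V') (x : ℝ × X) :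
    ‖V'.mkQ x‖ ≤ ‖V.mkQ x‖ := by
  refine le_of_forall_pos_le_add fun ε hε => ?_
  obtain ⟨m, hm, hlt⟩ := Submodule.Quotient.norm_mk_lt (V.mkQ x) hε
  have h1 : m - x ∈ V' := h ((Submodule.Quotient.eq V).1 hm)
  have h2 : V'.mkQ x = Submodule.Quotient.mk m := ((Submodule.Quotient.eq V').2 h1).symm
  rw [h2]
  exact (Submodule.Quotient.norm_mk_le V' m).trans hlt.le

theorem exists_tendsto_normalized {y : ι → X} (h : ∀ᶠ i in U, ((1 : ℝ), y i) ∉ V) :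
    ∃ v ∉ V, Tendsto (fun i => ‖V.mkQ ((1 : ℝ), y i)‖⁻¹ • V.mkQ ((1 : ℝ), y i)) U
      (𝓝 (V.mkQ v)) := by
  obtain ⟨q, hq, hlim⟩ := (isCompact_sphere (0 : (ℝ × X) ⧸ V) 1).exists_tendsto_ultrafilter U
    (f := fun i => ‖V.mkQ ((1 : ℝ), y i)‖⁻¹ • V.mkQ ((1 : ℝ), y i)) (h.mono fun i hi => by
      have := norm_ne_zero_iff.2 (mkQ_ne_zero_of_notMem hi)
      rw [mem_sphere_zero_iff_norm, norm_smul, norm_inv, norm_norm, inv_mul_cancel₀ this])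
  obtain ⟨v, rfl⟩ := V.mkQ_surjective q
  refine ⟨v, fun hv => ?_, hlim⟩
  rw [← Submodule.ker_mkQ V, LinearMap.mem_ker] at hv
  simp [hv] at hq

theorem IsCored.approachesMod (hF : IsCored F c r K) {t : ι → ℝ} {v : ℝ × X}
    (hc : Tendsto (fun i => t i • V.mkQ ((1 : ℝ), c i)) U (𝓝 (V.mkQ v)))
    (hr : Tendsto (fun i => t i * r i) U (𝓝 0)) {y : ι → X} (hy : ∀ i, y i ∈ F i) :
    ApproachesMod U V y v := by
  refine ⟨t, ?_⟩
  have h0 : Tendsto (fun i => t i • V.mkQ ((0 : ℝ), y i - c i)) U (𝓝 0) := by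
    refine squeeze_zero_norm (a := fun i => K * |t i * r i|) (fun i => ?_) ?_
    · have h1 : ‖V.mkQ ((0 : ℝ), y i - c i)‖ ≤ K * r i := by
        refine (Submodule.Quotient.norm_mk_le V _).trans ?_
        rw [Prod.norm_mk, norm_zero, max_eq_right (norm_nonneg _)]
        exact hF.mul_bound i _ (hy i)
      rw [norm_smul, Real.norm_eq_abs, abs_mul, abs_of_nonneg (hF.nonneg i)]
      calc |t i| * _ ≤ |t i| * (K * r i) := by gcongr
        _ = _ := by ring
    · simpa using (hr.abs).const_mul K
  have := hc.add h0
  rw [add_zero] at this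
  refine this.congr fun i => ?_
  rw [← smul_add, ← map_add]
  simp

/-- Since `V` is not at infinity, `X` maps onto the quotient. If `r i` exceeded `δ` times the norm,
the ball would contain a point lying over the limit line `v`, hence meet `V ⊔ span {v}`, which
almost all members avoid. -/
theorem IsCored.eventually_radius_le {k : ℕ} (hF : IsCored F c r K) (hU : Avoids U F (k + 1))
    (hV : Module.finrank ℝ V ≤ k) {w : ℝ × X} (hw : w ∈ V) (hw1 : w.1 ≠ 0) {δ : ℝ} (hδ : 0 < δ) :
    ∀ᶠ i in U, r i ≤ δ * ‖V.mkQ ((1 : ℝ), c i)‖ := by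
  by_contra hcon
  rw [← Ultrafilter.eventually_not] at hcon
  have hc : ∀ᶠ i in U, ((1 : ℝ), c i) ∉ V :=
    (hU V (by omega)).mono fun i hi => hi _ (hF.center_mem i)
  obtain ⟨v, hv, hlim⟩ := exists_tendsto_normalized hc
  let f : X →L[ℝ] (ℝ × X) ⧸ V := LinearMap.toContinuousLinearMap (V.mkQ ∘ₗ LinearMap.inr ℝ ℝ X)
  have hf : Function.Surjective f := by
    intro q
    obtain ⟨⟨a, h⟩, rfl⟩ := V.mkQ_surjective q
    refine ⟨h - (a / w.1) • w.2, ?_⟩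
    change V.mkQ ((0 : ℝ), h - (a / w.1) • w.2) = V.mkQ (a, h)
    rw [← sub_eq_zero, ← map_sub, ← LinearMap.mem_ker, Submodule.ker_mkQ]
    have := V.smul_mem (-(a / w.1)) hw
    convert this using 1
    ext
    · simp [div_mul_cancel₀ _ hw1]
    · simp
  obtain ⟨C, hC, hpre⟩ := f.exists_preimage_norm_le hf
  have hmeet := hU (V ⊔ Submodule.span ℝ {v})
    ((Submodule.finrank_sup_span_singleton_le V v).trans (by omega))
  have hnear := (tendsto_iff_norm_sub_tendsto_zero.1 hlim).eventually_lt_const (div_pos hδ hC)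
  obtain ⟨i, ⟨⟨hi1, hi2⟩, hi3⟩, hi4⟩ := (((hcon.and hc).and hmeet).and hnear).exists
  set s := ‖V.mkQ ((1 : ℝ), c i)‖ with hs
  have hs0 : 0 < s := norm_pos_iff.2 (mkQ_ne_zero_of_notMem hi2)
  obtain ⟨h, hfh, hh⟩ := hpre (s • V.mkQ v - V.mkQ ((1 : ℝ), c i))
  have hq : ‖s • V.mkQ v - V.mkQ ((1 : ℝ), c i)‖ ≤ s * (δ / C) := by
    have h1 : s • V.mkQ v - V.mkQ ((1 : ℝ), c i)
        = (-s) • (s⁻¹ • V.mkQ ((1 : ℝ), c i) - V.mkQ v) := by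
      rw [smul_sub, smul_smul, neg_mul, mul_inv_cancel₀ hs0.ne', neg_smul, neg_smul, one_smul]
      abel
    rw [h1, norm_smul, norm_neg, Real.norm_of_nonneg hs0.le]
    exact mul_le_mul_of_nonneg_left hi4.le hs0.le
  have hhr : ‖h‖ ≤ r i := by
    calc ‖h‖ ≤ C * (s * (δ / C)) := hh.trans (by gcongr)
      _ = δ * s := by field_simp
      _ ≤ r i := (not_le.1 hi1).le
  refine hi3 (c i + h) (hF.inner i (by simpa [dist_eq_norm] using hhr)) ?_
  refine Submodule.mem_sup_span_singleton_of_mkQ_eq s ?_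
  have h2 : ((1 : ℝ), c i + h) = ((1 : ℝ), c i) + ((0 : ℝ), h) := by simp
  have h3 : V.mkQ ((0 : ℝ), h) = s • V.mkQ v - V.mkQ ((1 : ℝ), c i) := hfh
  rw [h2, map_add, h3]
  abel

/-- The larger `V'` may leave infinity when `V` does not; smallness of the radii modulo `V'` passes
to `V` because quotient norms decrease. -/
theorem IsCored.exists_common_limit {k : ℕ} (hF : IsCored F c r K) (hU : Avoids U F (k + 1))
    {V' : Submodule ℝ (ℝ × X)} (hVV' : V ≤ V') (hV' : Module.finrank ℝ V' ≤ k) {w : ℝ × X}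
    (hw : w ∈ V') (hw1 : w.1 ≠ 0) :
    ∃ v ∉ V, ∀ y : ι → X, (∀ i, y i ∈ F i) → ApproachesMod U V y v := by
  have hc : ∀ᶠ i in U, ((1 : ℝ), c i) ∉ V :=
    (hU V ((Submodule.finrank_mono hVV').trans (by omega))).mono fun i hi =>
      hi _ (hF.center_mem i)
  obtain ⟨v, hv, hlim⟩ := exists_tendsto_normalized hc
  refine ⟨v, hv, fun y hy => hF.approachesMod hlim ?_ hy⟩
  rw [Metric.tendsto_nhds]
  intro ε hε
  filter_upwards [hF.eventually_radius_le hU hV' hw hw1 (half_pos hε), hc] with i hi hci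
  have hs0 : 0 < ‖V.mkQ ((1 : ℝ), c i)‖ := norm_pos_iff.2 (mkQ_ne_zero_of_notMem hci)
  rw [dist_zero_right, norm_mul, norm_inv, norm_norm, Real.norm_of_nonneg (hF.nonneg i),
    inv_mul_lt_iff₀ hs0]
  have := norm_mkQ_le_of_le hVV' ((1 : ℝ), c i)
  nlinarith

theorem exists_small_correction (hV : ∀ w ∈ V, w.1 = 0) {u v : ℝ × X} (huv : u.1 = v.1) {ρ : ℝ}
    (h : ‖V.mkQ u - V.mkQ v‖ < ρ) : ∃ x : X, ‖x‖ < ρ ∧ V.mkQ (v + ((0 : ℝ), x)) = V.mkQ u := by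
  rw [← map_sub] at h
  obtain ⟨m, hm, hlt⟩ := Submodule.Quotient.norm_mk_lt (V.mkQ (u - v)) (sub_pos.2 h)
  have h1 : m - (u - v) ∈ V := (Submodule.Quotient.eq V).1 hm
  have h2 : m = ((0 : ℝ), m.2) := by
    have := hV _ h1
    ext
    · simpa [huv] using this
    · rfl
  refine ⟨m.2, (norm_snd_le m).trans_lt (by simpa using hlt), ?_⟩
  rw [← h2, map_add, show V.mkQ m = V.mkQ (u - v) from hm, map_sub]
  abel

theorem IsCored.eventually_radius_le_norm_sub {k : ℕ} (hF : IsCored F c r K)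
    (hU : Avoids U F (k + 1)) (hVk : Module.finrank ℝ V ≤ k) (hV : ∀ w ∈ V, w.1 = 0)
    {u : ℝ × X} (hu : u.1 = 1) :
    ∀ᶠ i in U, r i ≤ ‖V.mkQ u - V.mkQ ((1 : ℝ), c i)‖ := by
  filter_upwards [hU (V ⊔ Submodule.span ℝ {u})
    ((Submodule.finrank_sup_span_singleton_le V u).trans (by omega))] with i hi
  by_contra hcon
  obtain ⟨x, hx, hxu⟩ := exists_small_correction (v := ((1 : ℝ), c i)) hV hu (not_le.1 hcon)
  refine hi (c i + x) (hF.inner i (by simpa [dist_eq_norm] using hx.le)) ?_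
  refine Submodule.mem_sup_span_singleton_of_mkQ_eq 1 ?_
  rw [one_smul, ← hxu]
  simp

/-- The first coordinate, as a function on the quotient by a subspace at infinity. -/
theorem exists_fst_quotient (hV : ∀ w ∈ V, w.1 = 0) :
    ∃ f : ((ℝ × X) ⧸ V) →ₗ[ℝ] ℝ, Continuous f ∧ ∀ u, f (V.mkQ u) = u.1 :=
  ⟨V.liftQ (LinearMap.fst ℝ ℝ X) fun w hw => hV w hw,
    LinearMap.continuous_of_finiteDimensional _, fun _ => rfl⟩

/-- If the centers stay bounded modulo `V`, they converge and the radii tend to `0`. If they escape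
while some selection stays near `u`, the additive bound makes the inner balls resemble half-spaces
in the limit direction `w`, with boundary within bounded distance of `u`; almost all would then meet
the flat through a fixed `u + τ • w`. -/
theorem IsCored.common_limit_or_limits_at_infinity {k : ℕ} (hF : IsCored F c r K)
    (hU : Avoids U F (k + 1)) (hVk : Module.finrank ℝ V ≤ k) (hV : ∀ w ∈ V, w.1 = 0) :
    (∃ v ∉ V, ∀ y : ι → X, (∀ i, y i ∈ F i) → ApproachesMod U V y v) ∨
      ∀ y : ι → X, (∀ i, y i ∈ F i) → ∃ v ∉ V, v.1 = 0 ∧ ApproachesMod U V y v := by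
  obtain ⟨f, hfc, hf⟩ := exists_fst_quotient hV
  have hbdd : ∀ (y : ι → X) (M : ℝ), (∀ᶠ i in U, ‖V.mkQ ((1 : ℝ), y i)‖ ≤ M) →
      ∃ u : ℝ × X, u.1 = 1 ∧ Tendsto (fun i => V.mkQ ((1 : ℝ), y i)) U (𝓝 (V.mkQ u)) := by
    intro y M hM
    obtain ⟨p, -, hp⟩ := (isCompact_closedBall (0 : (ℝ × X) ⧸ V) M).exists_tendsto_ultrafilter U
      (f := fun i => V.mkQ ((1 : ℝ), y i)) (by simpa using hM)
    obtain ⟨u, rfl⟩ := V.mkQ_surjective p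
    refine ⟨u, ?_, hp⟩
    have h1 := (hfc.tendsto _).comp hp
    simp only [Function.comp_def, hf] at h1
    exact tendsto_nhds_unique h1 tendsto_const_nhds
  by_cases hM : ∃ M, ∀ᶠ i in U, ‖V.mkQ ((1 : ℝ), c i)‖ ≤ M
  · obtain ⟨M, hM⟩ := hM
    obtain ⟨u, hu, hlim⟩ := hbdd c M hM
    refine Or.inl ⟨u, fun h => by simp [hV u h] at hu, fun y hy =>
      hF.approachesMod (t := fun _ => 1) (by simpa using hlim) ?_ hy⟩
    simp only [one_mul]
    refine squeeze_zero' (Eventually.of_forall hF.nonneg)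
      (hF.eventually_radius_le_norm_sub hU hVk hV hu) ?_
    simpa [norm_sub_rev] using tendsto_iff_norm_sub_tendsto_zero.1 hlim
  · right
    intro y hy
    have hunb : ∀ M, ∀ᶠ i in U, M ≤ ‖V.mkQ ((1 : ℝ), c i)‖ := fun M => by
      have := not_exists.1 hM M
      rw [← Ultrafilter.eventually_not] at this
      exact this.mono fun i hi => (not_le.1 hi).le
    have hyunb : ∀ M, ∀ᶠ i in U, M ≤ ‖V.mkQ ((1 : ℝ), y i)‖ := by
      intro M
      by_contra hcon
      rw [← Ultrafilter.eventually_not] at hcon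
      obtain ⟨u, hu, hlim⟩ := hbdd y M (hcon.mono fun i hi => (not_le.1 hi).le)
      let ℓ : ι → ℝ := fun i => ‖V.mkQ ((1 : ℝ), c i) - V.mkQ u‖
      let e : ι → (ℝ × X) ⧸ V := fun i => (ℓ i)⁻¹ • (V.mkQ ((1 : ℝ), c i) - V.mkQ u)
      have hℓ : ∀ M, ∀ᶠ i in U, M ≤ ℓ i := fun M =>
        (hunb (M + ‖V.mkQ u‖)).mono fun i hi => by
          have := norm_sub_norm_le (V.mkQ ((1 : ℝ), c i)) (V.mkQ u)
          change M ≤ ‖_‖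
          linarith
      obtain ⟨e', -, he'⟩ :=
        (isCompact_closedBall (0 : (ℝ × X) ⧸ V) 1).exists_tendsto_ultrafilter U
        (f := e) (Eventually.of_forall fun i => by
          rw [mem_closedBall_zero_iff, norm_smul, norm_inv, norm_norm]
          exact inv_mul_le_one)
      obtain ⟨w, rfl⟩ := V.mkQ_surjective e'
      have hw : w.1 = 0 := by
        have h1 := (hfc.tendsto _).comp he'
        simp only [Function.comp_def, hf, e, map_smul, map_sub, hu, sub_self, smul_zero] at h1
        exact tendsto_nhds_unique h1 tendsto_const_nhds
      -- Any `τ > K + 1` would do: `K` is the additive gap, and the two approximations cost `1 / 2`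
      -- each.
      let τ : ℝ := |K| + 2
      have hτ : 0 < τ := by positivity
      have hnear := (tendsto_iff_norm_sub_tendsto_zero.1 he').eventually_lt_const
        (div_pos (half_pos one_pos) hτ)
      have hnear' := (tendsto_iff_norm_sub_tendsto_zero.1 hlim).eventually_lt_const
        (half_pos (one_pos (α := ℝ)))
      have hhit := hF.eventually_radius_le_norm_sub hU hVk hV (u := u + τ • w)
        (by simp [hu, hw])
      obtain ⟨i, ⟨⟨h1, h2⟩, h3⟩, h4⟩ := (((hnear.and hnear').and hhit).and (hℓ τ)).exists
      have hℓ0 : 0 < ℓ i := hτ.trans_le h4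
      have h5 : ℓ i ≤ K + r i + 1 / 2 := by
        have ha : ‖V.mkQ ((1 : ℝ), c i) - V.mkQ ((1 : ℝ), y i)‖ ≤ K + r i := by
          rw [← map_sub]
          refine (Submodule.Quotient.norm_mk_le V _).trans ?_
          rw [Prod.mk_sub_mk, Prod.norm_mk, sub_self, norm_zero, max_eq_right (norm_nonneg _),
            norm_sub_rev]
          exact hF.add_bound i _ (hy i)
        have := norm_sub_le_norm_sub_add_norm_sub (V.mkQ ((1 : ℝ), c i))
          (V.mkQ ((1 : ℝ), y i)) (V.mkQ u)
        change ‖_‖ ≤ _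
        linarith
      have h6 : V.mkQ (u + τ • w) - V.mkQ ((1 : ℝ), c i)
          = (τ - ℓ i) • e i - τ • (e i - V.mkQ w) := by
        have hce : V.mkQ ((1 : ℝ), c i) = V.mkQ u + ℓ i • e i := by
          simp only [e, smul_smul, mul_inv_cancel₀ hℓ0.ne', one_smul]
          abel
        rw [hce, map_add, map_smul, smul_sub, sub_smul]
        abel
      have h7 : ‖e i‖ ≤ 1 := by
        rw [norm_smul, norm_inv, norm_norm]
        exact inv_mul_le_one
      have h8 : ‖(τ - ℓ i) • e i‖ ≤ ℓ i - τ := by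
        rw [norm_smul, Real.norm_eq_abs, abs_of_nonpos (by linarith)]
        nlinarith
      have h9 : ‖τ • (e i - V.mkQ w)‖ < 1 / 2 := by
        rw [norm_smul, Real.norm_of_nonneg hτ.le]
        rwa [lt_div_iff₀' hτ] at h1
      rw [h6] at h3
      have h10 := norm_sub_le ((τ - ℓ i) • e i) (τ • (e i - V.mkQ w))
      have h11 := le_abs_self K
      have h12 : τ = |K| + 2 := rfl
      linarith
    have hyV : ∀ᶠ i in U, ((1 : ℝ), y i) ∉ V :=
      Eventually.of_forall fun i hi => one_ne_zero (hV _ hi)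
    obtain ⟨v, hv, hlim⟩ := exists_tendsto_normalized hyV
    refine ⟨v, hv, ?_, _, hlim⟩
    have h1 := (hfc.tendsto _).comp hlim
    simp only [Function.comp_def, map_smul, hf, smul_eq_mul, mul_one] at h1
    exact tendsto_nhds_unique h1 (tendsto_inv_atTop_zero.comp (tendsto_atTop.2 hyunb))

end Projective

/-! ### Building the independent sequence -/

section Projective

variable {ι X : Type*} [NormedAddCommGroup X] [NormedSpace ℝ X]

theorem indepMod_singleton {F : ι → Set X} {W : Submodule ℝ (ℝ × X)} {i : ι}
    (h : ∀ x ∈ F i, ((1 : ℝ), x) ∉ W) : IndepMod F W {i} := by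
  intro x hx g hg j hj
  rw [Finset.mem_singleton] at hj
  subst hj
  rw [Finset.sum_singleton] at hg
  by_contra h0
  exact h _ (hx j (Finset.mem_singleton_self j)) ((W.smul_mem_iff h0).1 hg)

variable [FiniteDimensional ℝ X] {U : Ultrafilter ι} {F : ι → Set X} {c : ι → X} {r : ι → ℝ}
  {K : ℝ}

/-- The spare dimension allows `(1, 0)` to be adjoined, which leaves infinity. -/
theorem IsCored.exists_common_limit_of_finrank_lt {k : ℕ} (hF : IsCored F c r K)
    (hU : Avoids U F (k + 1)) {V : Submodule ℝ (ℝ × X)} (hV : Module.finrank ℝ V < k) :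
    ∃ v ∉ V, ∀ y : ι → X, (∀ i, y i ∈ F i) → ApproachesMod U V y v :=
  hF.exists_common_limit hU (V' := V ⊔ Submodule.span ℝ {((1 : ℝ), (0 : X))}) le_sup_left
    ((Submodule.finrank_sup_span_singleton_le _ _).trans hV) (w := ((1 : ℝ), (0 : X)))
    (Submodule.mem_sup_right (Submodule.mem_span_singleton_self _)) one_ne_zero

/-- A common `v` gives a fixed subspace that almost all members avoid. Otherwise `v` varies with
`y`, but `V ⊔ span {v}` stays at infinity and contains no lift at all. -/
theorem IsCored.eventually_exists_limit {k : ℕ} (hF : IsCored F c r K) (hU : Avoids U F (k + 1))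
    {V : Submodule ℝ (ℝ × X)} (hV : Module.finrank ℝ V ≤ k) :
    ∀ᶠ i in U, ∀ y : ι → X, (∀ i, y i ∈ F i) →
      ∃ v ∉ V, ApproachesMod U V y v ∧ IndepMod F (V ⊔ Submodule.span ℝ {v}) {i} := by
  have common : (∃ v ∉ V, ∀ y : ι → X, (∀ i, y i ∈ F i) → ApproachesMod U V y v) →
      ∀ᶠ i in U, ∀ y : ι → X, (∀ i, y i ∈ F i) →
        ∃ v ∉ V, ApproachesMod U V y v ∧ IndepMod F (V ⊔ Submodule.span ℝ {v}) {i} := by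
    rintro ⟨v, hv, hy⟩
    exact (hU _ ((Submodule.finrank_sup_span_singleton_le V v).trans (by omega))).mono
      fun i hi y hyF => ⟨v, hv, hy y hyF, indepMod_singleton hi⟩
  by_cases h : ∃ w ∈ V, w.1 ≠ 0
  · obtain ⟨w, hw, hw1⟩ := h
    exact common (hF.exists_common_limit hU le_rfl hV hw hw1)
  · push Not at h
    rcases hF.common_limit_or_limits_at_infinity hU hV h with h' | h'
    · exact common h'
    · refine Eventually.of_forall fun i y hy => ?_
      obtain ⟨v, hv, hv0, hlim⟩ := h' y hy
      refine ⟨v, hv, hlim, indepMod_singleton fun x _ hx => ?_⟩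
      have hle : V ⊔ Submodule.span ℝ {v} ≤ LinearMap.ker (LinearMap.fst ℝ ℝ X) :=
        sup_le (fun w hw => h w hw) (by simpa [Submodule.span_le] using hv0)
      exact one_ne_zero (hle hx)

theorem IsCored.exists_indep_seq {k : ℕ} (hF : IsCored F c r K) (hU : Avoids U F (k + 1))
    (hcomp : ∀ i, IsCompact (F i)) :
    ∃ s : ℕ → ι, Function.Injective s ∧
      ∀ T : Finset ℕ, T.card = k + 2 → ∃ T' : Finset ι, IndepMod F ⊥ T' ∧ T'.card = k + 2 ∧
        ∀ i ∈ T', ∃ n ∈ T, s n = i := by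
  classical
  have hne : ∀ i, (F i).Nonempty := fun i => ⟨_, hF.center_mem i⟩
  have hUne : ∀ j, ∀ᶠ i in (U : Filter ι), i ≠ j := by
    intro j
    refine (hU (Submodule.span ℝ {((1 : ℝ), c j)}) ?_).mono fun i hi hij => ?_
    · have := Submodule.finrank_sup_span_singleton_le (⊥ : Submodule ℝ (ℝ × X)) ((1 : ℝ), c j)
      rw [bot_sup_eq, finrank_bot] at this
      omega
    · exact hi (c j) (hij ▸ hF.center_mem j) (Submodule.mem_span_singleton_self _)
  have hUT : ∀ T : Finset ι, ∀ᶠ i in U, i ∉ T := fun T =>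
    ((Finset.eventually_all T).2 fun j _ => hUne j).mono fun i hi h => hi i h rfl
  have hstep : ∀ V : Submodule ℝ (ℝ × X), ∃ v, Module.finrank ℝ V < k →
      v ∉ V ∧ ∀ y : ι → X, (∀ i, y i ∈ F i) → ApproachesMod U V y v := by
    intro V
    by_cases hV : Module.finrank ℝ V < k
    · obtain ⟨v, hv⟩ := hF.exists_common_limit_of_finrank_lt hU hV
      exact ⟨v, fun _ => hv⟩
    · exact ⟨0, fun h => absurd h hV⟩
  choose v hv using hstep
  obtain ⟨V, hV0, hVs⟩ : ∃ V : ℕ → Submodule ℝ (ℝ × X), V 0 = ⊥ ∧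
      ∀ n, V (n + 1) = V n ⊔ Submodule.span ℝ {v (V n)} :=
    ⟨fun n => Nat.rec ⊥ (fun _ W => W ⊔ Submodule.span ℝ {v W}) n, rfl, fun _ => rfl⟩
  have hVr : ∀ n, Module.finrank ℝ ↥(V n) ≤ n := by
    intro n
    induction n with
    | zero => rw [hV0, finrank_bot]
    | succ n ih =>
      rw [hVs]
      exact (Submodule.finrank_sup_span_singleton_le _ _).trans (by omega)
  -- In use `m + T.card = k + 2`. At `m = k + 1` the last flag vector may depend on the selection,
  -- so it is quantified after `y`.
  let Q : ℕ → Finset ι → Prop := fun m T =>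
    if m ≤ k then IndepMod F (V m) T
    else if m = k + 1 then ∀ y : ι → X, (∀ i, y i ∈ F i) →
      ∃ v ∉ V k, ApproachesMod U (V k) y v ∧ IndepMod F (V k ⊔ Submodule.span ℝ {v}) T
    else m = k + 2 ∧ T = ∅
  obtain ⟨s, hs, hsQ⟩ := exists_injective_seq_of_eventually (U : Filter ι) hUne Q (k + 2)
    (by simp [Q]) (by
      intro m T hm
      rcases lt_trichotomy m k with h | rfl | h
      · simp only [Q, if_pos (Nat.succ_le_of_lt h), if_pos h.le] at hm ⊢
        obtain ⟨h1, h2⟩ := hv (V m) ((hVr m).trans_lt h)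
        exact IndepMod.eventually_insert hcomp hne (hUT T) fun y hy =>
          ⟨_, h1, h2 y hy, hVs m ▸ hm⟩
      · simp only [Q, le_refl, if_true] at hm ⊢
        rw [if_neg (by omega)] at hm
        exact IndepMod.eventually_insert hcomp hne (hUT T) hm
      · simp only [Q] at hm ⊢
        rw [if_neg (by omega), if_neg (by omega)] at hm
        obtain ⟨h1, rfl⟩ := hm
        obtain rfl : m = k + 1 := by omega
        simp only [if_neg (Nat.not_succ_le_self k), if_true]
        exact hF.eventually_exists_limit hU (hVr k))
  refine ⟨s, hs, fun T hT => ⟨T.image s, ?_, ?_, fun i hi => Finset.mem_image.1 hi⟩⟩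
  · simpa [Q, hV0] using hsQ T hT
  · rw [Finset.card_image_of_injective _ hs, hT]

theorem IndepMod.card_le_finrank {T : Finset ι} (h : IndepMod F ⊥ T)
    {W : Submodule ℝ (ℝ × X)} (hW : ∀ i ∈ T, ∃ x ∈ F i, ((1 : ℝ), x) ∈ W) :
    T.card ≤ Module.finrank ℝ W := by
  classical
  have : ∀ i, ∃ x, i ∈ T → x ∈ F i ∧ ((1 : ℝ), x) ∈ W := fun i => by
    by_cases hi : i ∈ T
    · obtain ⟨x, hx⟩ := hW i hi
      exact ⟨x, fun _ => hx⟩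
    · exact ⟨0, fun h => absurd h hi⟩
  choose x hx using this
  have hLI : LinearIndependent ℝ fun i : T => ((1 : ℝ), x i) := by
    rw [Fintype.linearIndependent_iff]
    intro g hg i
    have := h x (fun j hj => (hx j hj).1) (fun j => if hj : j ∈ T then g ⟨j, hj⟩ else 0) (by
      rw [Submodule.mem_bot, ← hg, ← Finset.sum_coe_sort T]
      exact Finset.sum_congr rfl fun j _ => by simp) i i.2
    simpa using this
  have h2 := finrank_span_eq_card hLI
  rw [Fintype.card_coe] at h2
  rw [← h2]
  refine Submodule.finrank_mono (Submodule.span_le.2 ?_)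
  rintro _ ⟨i, rfl⟩
  exact (hx i i.2).2

end Projective

theorem Submodule.exists_le_finrank_eq {E : Type*} [AddCommGroup E] [Module ℝ E]
    [FiniteDimensional ℝ E] (W : Submodule ℝ E) {k : ℕ} (hW : Module.finrank ℝ W ≤ k)
    (hk : k ≤ Module.finrank ℝ E) : ∃ L, W ≤ L ∧ Module.finrank ℝ L = k := by
  induction k, hW using Nat.le_induction with
  | base => exact ⟨W, le_rfl, rfl⟩
  | succ n hn ih =>
    obtain ⟨L, hL, hLn⟩ := ih (by omega)
    have hne : L ≠ ⊤ := by
      rintro rfl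
      rw [finrank_top] at hLn
      omega
    obtain ⟨v, -, hv⟩ := SetLike.exists_of_lt (lt_top_iff_ne_top.2 hne)
    refine ⟨L ⊔ Submodule.span ℝ {v}, hL.trans le_sup_left, le_antisymm ?_ ?_⟩
    · exact hLn ▸ L.finrank_sup_span_singleton_le v
    · rw [← hLn]
      exact Submodule.finrank_lt_finrank_of_lt (lt_of_le_of_ne le_sup_left fun h =>
        hv (h ▸ Submodule.mem_sup_right (Submodule.mem_span_singleton_self v)))

/-! ### Flats, subspaces and the two alternatives -/

section Flats

variable {d k : ℕ}

theorem isFlat_mk' (x : EuclideanSpace ℝ (Fin d)) {L : Submodule ℝ (EuclideanSpace ℝ (Fin d))}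
    (hL : Module.finrank ℝ L = k) : IsFlat k (AffineSubspace.mk' x L) :=
  ⟨⟨x, AffineSubspace.self_mem_mk' x L⟩, by rw [AffineSubspace.direction_mk', hL]⟩

/-- A lift in `W` makes its part at infinity a proper subspace, of dimension at most `k`; it is
enlarged to a direction of dimension exactly `k`. -/
theorem exists_flat_of_submodule (hk : k ≤ d)
    (W : Submodule ℝ (ℝ × EuclideanSpace ℝ (Fin d))) (hW : Module.finrank ℝ W ≤ k + 1) :
    ∃ J, IsFlat k J ∧ ∀ x, ((1 : ℝ), x) ∈ W → x ∈ J := by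
  have hkE : k ≤ Module.finrank ℝ (EuclideanSpace ℝ (Fin d)) := by simpa using hk
  by_cases h : ∃ x, ((1 : ℝ), x) ∈ W
  · obtain ⟨x, hx⟩ := h
    let D := W.comap (LinearMap.inr ℝ ℝ (EuclideanSpace ℝ (Fin d)))
    have hD : Module.finrank ℝ D ≤ k := by
      have h1 : D.map (LinearMap.inr ℝ ℝ (EuclideanSpace ℝ (Fin d))) < W := by
        refine lt_of_le_of_ne (Submodule.map_comap_le _ _) fun h => ?_
        rw [← h] at hx
        obtain ⟨y, -, hy⟩ := hx
        simpa using congrArg Prod.fst hy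
      have h2 := Submodule.finrank_lt_finrank_of_lt h1
      rw [← (Submodule.equivMapOfInjective _
        (LinearMap.inr_injective (R := ℝ) (M := ℝ)) D).finrank_eq] at h2
      omega
    obtain ⟨L, hDL, hL⟩ := D.exists_le_finrank_eq hD hkE
    refine ⟨_, isFlat_mk' x hL, fun y hy => ?_⟩
    rw [AffineSubspace.mem_mk', vsub_eq_sub]
    refine hDL ?_
    have := W.sub_mem hy hx
    simpa [D] using this
  · obtain ⟨L, -, hL⟩ := (⊥ : Submodule ℝ (EuclideanSpace ℝ (Fin d))).exists_le_finrank_eq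
      (by simp) hkE
    exact ⟨_, isFlat_mk' 0 hL, fun x hx => absurd ⟨x, hx⟩ h⟩

theorem IsFlat.exists_submodule {J : AffineSubspace ℝ (EuclideanSpace ℝ (Fin d))}
    (hJ : IsFlat k J) : ∃ W : Submodule ℝ (ℝ × EuclideanSpace ℝ (Fin d)),
      Module.finrank ℝ W ≤ k + 1 ∧ ∀ x ∈ J, ((1 : ℝ), x) ∈ W := by
  obtain ⟨⟨p, hp⟩, hk⟩ := hJ
  refine ⟨J.direction.map (LinearMap.inr ℝ ℝ _) ⊔ Submodule.span ℝ {((1 : ℝ), p)}, ?_, ?_⟩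
  · refine (Submodule.finrank_sup_span_singleton_le _ _).trans ?_
    have := Submodule.finrank_map_le (LinearMap.inr ℝ ℝ (EuclideanSpace ℝ (Fin d))) J.direction
    omega
  · intro x hx
    have h1 := Submodule.mem_map_of_mem (f := LinearMap.inr ℝ ℝ (EuclideanSpace ℝ (Fin d)))
      (AffineSubspace.vsub_mem_direction hx hp)
    have := Submodule.add_mem _ (Submodule.mem_sup_left (T := Submodule.span ℝ {((1 : ℝ), p)}) h1)
      (Submodule.mem_sup_right (Submodule.mem_span_singleton_self ((1 : ℝ), p)))
    simpa using this

variable {ι : Type*} {F : ι → Set (EuclideanSpace ℝ (Fin d))}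

theorem IsNearBallFamily.exists_isCored (hF : IsNearBallFamily F) :
    ∃ c r K, IsCored F c r K := by
  obtain ⟨-, K, hK⟩ := hF
  choose c r R h hmul hadd using hK
  have hR : ∀ i, ∀ x ∈ F i, ‖x - c i‖ ≤ R i := fun i x hx => by
    simpa [dist_eq_norm] using (h i).2.1.1.2 hx
  exact ⟨c, r, K, fun i => (h i).1.1, fun i => (h i).1.2.1,
    fun i x hx => (hR i x hx).trans (hmul i), fun i x hx => (hR i x hx).trans (hadd i)⟩

theorem exists_ultrafilter_avoids (hk : k ≤ d) (h : ¬ HasFiniteFlatTransversal k F) :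
    ∃ U : Ultrafilter ι, Avoids U F (k + 1) := by
  let p : Set ι → Prop := fun S => ∃ P : Set (AffineSubspace ℝ (EuclideanSpace ℝ (Fin d))),
    P.Finite ∧ (∀ J ∈ P, IsFlat k J) ∧ ∀ i ∈ S, ∃ J ∈ P, Pierces J (F i)
  let f : Filter ι := Filter.comk p ⟨∅, by simp⟩
    (fun t ⟨P, h1, h2, h3⟩ s hs => ⟨P, h1, h2, fun i hi => h3 i (hs hi)⟩)
    (fun s ⟨P, h1, h2, h3⟩ t ⟨P', h1', h2', h3'⟩ => ⟨P ∪ P', h1.union h1',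
      fun J hJ => hJ.elim (h2 J) (h2' J), fun i hi => hi.elim
        (fun hi => let ⟨J, hJ, hJi⟩ := h3 i hi; ⟨J, Or.inl hJ, hJi⟩)
        (fun hi => let ⟨J, hJ, hJi⟩ := h3' i hi; ⟨J, Or.inr hJ, hJi⟩)⟩)
  have hf : NeBot f := by
    refine ⟨fun hbot => h ?_⟩
    have : (∅ : Set ι) ∈ f := hbot ▸ Filter.mem_bot
    obtain ⟨P, h1, h2, h3⟩ := Filter.mem_comk.1 this
    exact ⟨P, h1, h2, fun i => h3 i (by simp)⟩
  refine ⟨Ultrafilter.of f, fun W hW => Ultrafilter.of_le f ?_⟩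
  obtain ⟨J, hJ, hJW⟩ := exists_flat_of_submodule hk W hW
  refine Filter.mem_comk.2 ⟨{J}, Set.finite_singleton J, by simpa using hJ, fun i hi => ?_⟩
  simp only [Set.mem_compl_iff, Set.mem_ofPred_eq, not_forall, not_not] at hi
  obtain ⟨x, hx, hxW⟩ := hi
  exact ⟨J, rfl, x, hJW x hxW, hx⟩

theorem HasInfiniteIndependentSeq.not_hasFiniteFlatTransversal
    (h : HasInfiniteIndependentSeq k F) : ¬ HasFiniteFlatTransversal k F := by
  rintro ⟨P, hP, hflat, hpierce⟩
  obtain ⟨s, -, hind⟩ := h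
  choose J hJP hJ using fun n => hpierce (s n)
  have := hP.to_subtype
  obtain ⟨⟨J', hJ'⟩, hinf⟩ :=
    Finite.exists_infinite_fiber fun n => (⟨J n, hJP n⟩ : P)
  obtain ⟨T, hT, hcard⟩ := (Set.infinite_coe_iff.1 hinf).exists_subset_card_eq (k + 2)
  refine hind J' (hflat J' hJ') ⟨T, hcard, fun n hn => ?_⟩
  have : J n = J' := congrArg Subtype.val (hT hn)
  exact this ▸ hJ n

theorem AlephZeroProperty.not_hasInfiniteIndependentSeq (h : AlephZeroProperty (k + 2) k F) :
    ¬ HasInfiniteIndependentSeq k F := by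
  classical
  rintro ⟨s, hs, hind⟩
  obtain ⟨T, hT, hcard, J, hJ, hpierce⟩ := h (Set.range s) (by
    have := Set.infinite_coe_iff.2 (Set.infinite_range_of_injective hs)
    have := (Set.countable_range s).to_subtype
    exact Cardinal.mk_eq_aleph0 _)
  obtain ⟨T', -, rfl⟩ := Finset.subset_set_image_iff.1 (Set.image_univ (f := s) ▸ hT)
  rw [Finset.card_image_of_injective _ hs] at hcard
  exact hind J hJ ⟨T', hcard, fun n hn => hpierce _ (Finset.mem_image_of_mem s hn)⟩

theorem IsNearBallFamily.hasInfiniteIndependentSeq (hk : k ≤ d) (hcompact : ∀ i, IsCompact (F i))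
    (hnear : IsNearBallFamily F) (h : ¬ HasFiniteFlatTransversal k F) :
    HasInfiniteIndependentSeq k F := by
  obtain ⟨c, r, K, hF⟩ := hnear.exists_isCored
  obtain ⟨U, hU⟩ := exists_ultrafilter_avoids hk h
  obtain ⟨s, hs, hind⟩ := hF.exists_indep_seq hU hcompact
  refine ⟨s, hs, fun J hJ ⟨T, hT, hpierce⟩ => ?_⟩
  obtain ⟨T', hT', hcard, hsub⟩ := hind T hT
  obtain ⟨W, hW, hJW⟩ := hJ.exists_submodule
  have := hT'.card_le_finrank (W := W) (by
    intro i hi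
    obtain ⟨n, hn, rfl⟩ := hsub i hi
    obtain ⟨x, hxJ, hx⟩ := hpierce n hn
    exact ⟨x, hx, hJW x hxJ⟩)
  omega

end Flats

theorem theorem1p3 (d k : ℕ) (hk : k < d) {ι : Type*}
    (F : ι → Set (EuclideanSpace ℝ (Fin d)))
    (hcompact : ∀ i, IsCompact (F i)) (hnear : IsNearBallFamily F) :
    (Infinite ι → AlephZeroProperty (k + 2) k F → HasFiniteFlatTransversal k F) ∧
      Xor (HasFiniteFlatTransversal k F) (HasInfiniteIndependentSeq k F) := by
  have key := hnear.hasInfiniteIndependentSeq hk.le hcompact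
  refine ⟨fun _ h => by_contra fun hn => h.not_hasInfiniteIndependentSeq (key hn), ?_⟩
  by_cases h : HasFiniteFlatTransversal k F
  · exact Or.inl ⟨h, fun h' => h'.not_hasFiniteFlatTransversal h⟩
  · exact Or.inr ⟨key h, h⟩
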